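/- All graphs are finite, simple and connected, and $d_G$ is the geodesic distance. A graph $G=(V_G,E_G)$ is *distance-balanced* if for all adjacent $u,v$ the number of vertices closer to $u$ than to $v$ equals the number of vertices closer to $v$ than to $u$. For $A\subseteq V_G$ let $\rho_A(u,v)$ be the length of a shortest walk from $u$ to $v$ that visits every vertex of $A$ at least once. Let $n=|V_G|$, and for $p\in[0,1]$ let $p_A=p^{|A|}(1-p)^{n-|A|}$ and $$d^p_G(u)=\frac1n\sum_{v\in V_G}\sum_{A\subseteq V_G}p_A\,\rho_A(u,v),\qquad w^p_{uv}=\sum_{A\subseteq V_G}p_A\,\bigl|\{z\in V_G:\rho_A(z,u)<\rho_A(z,v)\}\bigr|.$$ $G$ is *$p$TS-distance-balanced* if $w^p_{uv}=w^p_{vu}$ for all adjacent $u,v$. The *wreath product* $G\wr H$ has vertex set $V_H^{V_G}\times V_G$; the vertices $(y,x)$ and $(y',x')$ are adjacent if either $x=x'$, $y_j=y'_j$ for all $j\ne x$ and $y_x\sim y'_x$ in $H$, or $y=y'$ and $x\sim x'$ in $G$. Let $W_7$ be the wheel graph on $7$ vertices (a centre joined to all vertices of a $6$-cycle). Let $H_9$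 be the graph on $\{0,1,\dots,8\}$ with edges $01,02,12,13,23,34,35,45,46,56,67,68,78,70,80$ (a $6$-cycle in which every second vertex is replaced by a pair of adjacent vertices). Let $K_2$ be the complete graph on two vertices. **Corollary.** 1. $G\wr H$ being distance-balanced does not imply that $G$ is distance-balanced. In fact $d^{1/2}_{W_7}(u)=\frac{1}{7\cdot 2^7}\cdot 3842$ for every vertex $u$ of $W_7$, $W_7$ is $\frac12$TS-distance-balanced, and $W_7\wr K_2$ is (connected and) distance-balanced, but $W_7$ is not distance-balanced. 2. $G$ and $H$ both being distance-balanced does not imply that $G\wr H$ is distance-balanced. In fact $H_9$ and $K_2$ are distance-balanced, $d^{1/2}_{H_9}(0)=\frac{1}{9\cdot 2^9}\cdot 26688$ and $d^{1/2}_{H_9}(1)=\frac{1}{9\cdot 2^9}\cdot 26656$, $H_9$ is not $\frac12$TS-distance-balanced, and $H_9\wr K_2$ is (connected but) not distance-balanced. -/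

import Mathlib

/-- The set `W_{uv}` of vertices that are closer to `u` than to `v`. -/
def SimpleGraph.closerSet {V : Type*} (G : SimpleGraph V) (u v : V) : Set V :=
  {z | G.dist z u < G.dist z v}

/-- Distance-balanced: `|W_{uv}| = |W_{vu}|` for all adjacent `u, v`
(used for finite connected graphs). -/
def SimpleGraph.IsDistanceBalanced {V : Type*} (G : SimpleGraph V) : Prop :=
  ∀ u v : V, G.Adj u v → (G.closerSet u v).ncard = (G.closerSet v u).ncard

/-- `ρ_A(u, v)`: the length of a shortest walk from `u` to `v` that visits every vertex of `A`
at least once (such a walk exists when the graph is connected). -/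
noncomputable def SimpleGraph.rho {V : Type*} (G : SimpleGraph V) (A : Finset V) (u v : V) : ℕ :=
  sInf {k | ∃ w : G.Walk u v, (∀ a ∈ A, a ∈ w.support) ∧ w.length = k}

/-- `p_A = p^|A| (1 - p)^(n - |A|)`: the probability that the random set of vertices is `A`. -/
noncomputable def setProb {V : Type*} [Fintype V] (p : ℝ) (A : Finset V) : ℝ :=
  p ^ A.card * (1 - p) ^ (Fintype.card V - A.card)

/-- `d^p_G(u)`: the expected value of `ρ_A(u, v)` for random `A` and uniformly random `v`. -/
noncomputable def SimpleGraph.tsDist {V : Type*} [Fintype V] (G : SimpleGraph V) (p : ℝ) (u : V) :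
    ℝ :=
  (1 / (Fintype.card V : ℝ)) * ∑ v : V, ∑ A : Finset V, setProb p A * (G.rho A u v : ℝ)

/-- The set `W^A_{uv}` of vertices `z` with `ρ_A(z, u) < ρ_A(z, v)`. -/
def SimpleGraph.tsCloserSet {V : Type*} (G : SimpleGraph V) (A : Finset V) (u v : V) : Set V :=
  {z | G.rho A z u < G.rho A z v}

/-- `w^p_{uv}`: the expected cardinality of `W^A_{uv}` for random `A`. -/
noncomputable def SimpleGraph.tsWeight {V : Type*} [Fintype V] (G : SimpleGraph V) (p : ℝ)
    (u v : V) : ℝ :=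
  ∑ A : Finset V, setProb p A * ((G.tsCloserSet A u v).ncard : ℝ)

/-- `p`TS-distance-balanced: `w^p_{uv} = w^p_{vu}` for all adjacent `u, v`. -/
def SimpleGraph.IsTSDistanceBalanced {V : Type*} [Fintype V] (G : SimpleGraph V) (p : ℝ) : Prop :=
  ∀ u v : V, G.Adj u v → G.tsWeight p u v = G.tsWeight p v u

/-- The wreath product `G ≀ H`: a vertex `(y, x)` is a colouring `y : V → W` together with a
position `x : V`. Edges of type I change the colour at the current position along an edge of `H`;
edges of type II change the position along an edge of `G`. -/
def SimpleGraph.wreath {V W : Type*} (G : SimpleGraph V) (H : SimpleGraph W) :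
    SimpleGraph ((V → W) × V) where
  Adj a b :=
    (a.2 = b.2 ∧ (∀ j, j ≠ a.2 → a.1 j = b.1 j) ∧ H.Adj (a.1 a.2) (b.1 a.2)) ∨
      (a.1 = b.1 ∧ G.Adj a.2 b.2)
  symm := ⟨by
    rintro ⟨y, x⟩ ⟨y', x'⟩ (⟨h1, h2, h3⟩ | ⟨h1, h2⟩)
    · dsimp only at h1 h2 h3
      subst h1
      exact Or.inl ⟨rfl, fun j hj => (h2 j hj).symm, h3.symm⟩
    · exact Or.inr ⟨h1.symm, h2.symm⟩⟩
  loopless := ⟨by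
    rintro ⟨y, x⟩ (⟨_, _, h⟩ | ⟨_, h⟩)
    · exact H.loopless.irrefl _ h
    · exact G.loopless.irrefl _ h⟩

/-- The wheel graph `W₇` on 7 vertices: the centre `0` is joined to all vertices of the
6-cycle `1, 2, 3, 4, 5, 6`. -/
def wheel7 : SimpleGraph (Fin 7) :=
  SimpleGraph.fromRel fun i j => (i, j) ∈
    ([(0, 1), (0, 2), (0, 3), (0, 4), (0, 5), (0, 6),
      (1, 2), (2, 3), (3, 4), (4, 5), (5, 6), (6, 1)] : List (Fin 7 × Fin 7))

/-- The graph `H₉` on 9 vertices: a 6-cycle in which every second vertex is replaced by a pair of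
adjacent vertices, in the cyclic order `0, {1, 2}, 3, {4, 5}, 6, {7, 8}`. The vertices `0, 3, 6`
have degree 4, the other six have degree 3. -/
def graphH9 : SimpleGraph (Fin 9) :=
  SimpleGraph.fromRel fun i j => (i, j) ∈
    ([(0, 1), (0, 2), (1, 2), (1, 3), (2, 3),
      (3, 4), (3, 5), (4, 5), (4, 6), (5, 6),
      (6, 7), (6, 8), (7, 8), (7, 0), (8, 0)] : List (Fin 9 × Fin 9))

/-! Travelling in `G ≀ K₂` from `(y, x)` to `(y', x')` means walking in `G` from `x` to `x'` through
every vertex of the set `A` where `y` and `y'` differ, with one extra step per colour change. So the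
distance is `ρ_A(x, x') + |A|` (`dist_wreath_top`). When `y` runs through all colourings, `A` runs
once through all subsets, so the sum of the distances to `(y', x')` is `totalRho x'` plus a
constant.

Distances to two adjacent vertices differ by at most one, so distance-balanced means that adjacent
vertices have equal distance sums. The same count for each `ρ_A` turns the ½TS condition into
equality of `totalRho` at adjacent vertices. Hence `G ≀ K₂` is distance-balanced if and only if `G`
is ½TS-distance-balanced (`isDistanceBalanced_wreath_iff`).

What remains is to compute `totalRho` for the two graphs. A breadth-first search over the pairs
(vertex, set still to be visited), stored as the bits of one natural number, is evaluated by the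
kernel; `connected_and_totalRho_of_searchCount` reads off connectedness and the sum. -/

open Finset in
/-- If `f` and `g` differ by at most one everywhere, the sets where one is smaller than the other
measure the difference of their sums. -/
theorem ncard_lt_add_sum {α : Type*} [Fintype α] {f g : α → ℕ} (h₁ : ∀ z, f z ≤ g z + 1)
    (h₂ : ∀ z, g z ≤ f z + 1) :
    {z | f z < g z}.ncard + ∑ z, f z = {z | g z < f z}.ncard + ∑ z, g z := by
  classical
  have key : ∀ f g : α → ℕ, {z | f z < g z}.ncard = ∑ z, if f z < g z then 1 else 0 := by
    intro f g
    rw [Finset.sum_boole, Set.ncard_eq_toFinset_card']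
    simp
  rw [key, key, ← sum_add_distrib, ← sum_add_distrib]
  refine sum_congr rfl fun z _ => ?_
  have := h₁ z
  have := h₂ z
  split_ifs <;> omega

/-! ### Covering walks, and balance as equality of sums. -/

namespace SimpleGraph

variable {V : Type*} {G : SimpleGraph V}

theorem Connected.exists_walk_cover (hG : G.Connected) (A : Finset V) (u v : V) :
    ∃ w : G.Walk u v, ∀ a ∈ A, a ∈ w.support := by
  classical
  induction A using Finset.induction_on with
  | empty => exact ⟨(hG u v).some, by simp⟩
  | insert a A _ ih =>
    obtain ⟨w, hw⟩ := ih
    obtain ⟨q⟩ := hG v a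
    refine ⟨(w.append q).append q.reverse, fun b hb => ?_⟩
    rcases Finset.mem_insert.1 hb with rfl | hb
    · simp
    · simp [hw b hb]

theorem rho_le_length {A : Finset V} {u v : V} (w : G.Walk u v) (hw : ∀ a ∈ A, a ∈ w.support) :
    G.rho A u v ≤ w.length :=
  Nat.sInf_le ⟨w, hw, rfl⟩

theorem Connected.exists_walk_length_eq_rho (hG : G.Connected) (A : Finset V) (u v : V) :
    ∃ w : G.Walk u v, (∀ a ∈ A, a ∈ w.support) ∧ w.length = G.rho A u v := by
  obtain ⟨w, hw⟩ := hG.exists_walk_cover A u v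
  exact Nat.sInf_mem (s := {k | ∃ w : G.Walk u v, (∀ a ∈ A, a ∈ w.support) ∧ w.length = k})
    ⟨_, w, hw, rfl⟩

theorem Connected.rho_le_iff (hG : G.Connected) {A : Finset V} {u v : V} {k : ℕ} :
    G.rho A u v ≤ k ↔ ∃ w : G.Walk u v, (∀ a ∈ A, a ∈ w.support) ∧ w.length ≤ k := by
  constructor
  · intro h
    obtain ⟨w, hw, hl⟩ := hG.exists_walk_length_eq_rho A u v
    exact ⟨w, hw, hl.trans_le h⟩
  · rintro ⟨w, hw, hl⟩
    exact (rho_le_length w hw).trans hl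

theorem rho_comm (A : Finset V) (u v : V) : G.rho A u v = G.rho A v u := by
  unfold rho
  congr 1
  ext k
  constructor <;> rintro ⟨w, hw, rfl⟩ <;> exact ⟨w.reverse, by simpa using hw, by simp⟩

theorem Connected.rho_le_rho_add_one (hG : G.Connected) (A : Finset V) (z : V) {u v : V}
    (h : G.Adj u v) : G.rho A z v ≤ G.rho A z u + 1 := by
  obtain ⟨w, hw, hl⟩ := hG.exists_walk_length_eq_rho A z u
  rw [← hl, ← Walk.length_concat w h]
  refine rho_le_length _ fun a ha => ?_
  simp [Walk.support_concat, hw a ha]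

theorem Connected.isDistanceBalanced_iff [Fintype V] (hG : G.Connected) :
    G.IsDistanceBalanced ↔ ∀ u v, G.Adj u v → ∑ z, G.dist z u = ∑ z, G.dist z v := by
  have key : ∀ u v, G.Adj u v → ∀ z, G.dist z v ≤ G.dist z u + 1 := fun u v h z =>
    (hG.dist_triangle (v := u)).trans (by rw [dist_eq_one_iff_adj.2 h])
  refine forall₃_congr fun u v h => ?_
  have := ncard_lt_add_sum (key v u h.symm) (key u v h)
  unfold closerSet
  omega

/-- At `p = 1/2` all sets are equally likely, so the weights become a common factor. -/
theorem setProb_half [Fintype V] (A : Finset V) :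
    setProb (1 / 2) A = (1 / 2) ^ Fintype.card V := by
  rw [setProb, show (1 : ℝ) - 1 / 2 = 1 / 2 by norm_num, ← pow_add,
    Nat.add_sub_cancel' A.card_le_univ]

/-- The sum of `ρ_A(u, v)` over all `A` and `v`. -/
noncomputable def totalRho [Fintype V] (G : SimpleGraph V) (u : V) : ℕ :=
  ∑ v, ∑ A, G.rho A u v

theorem tsDist_half [Fintype V] (u : V) :
    G.tsDist (1 / 2) u =
      1 / (Fintype.card V * 2 ^ Fintype.card V) * (G.totalRho u : ℝ) := by
  simp only [tsDist, setProb_half, totalRho, Nat.cast_sum, ← Finset.mul_sum]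
  rw [← mul_assoc]
  congr 1
  rw [one_div_pow, one_div_mul_one_div]

theorem Connected.isTSDistanceBalanced_half_iff [Fintype V] (hG : G.Connected) :
    G.IsTSDistanceBalanced (1 / 2) ↔ ∀ u v, G.Adj u v → G.totalRho u = G.totalRho v := by
  refine forall₃_congr fun u v h => ?_
  simp only [tsWeight, setProb_half, ← Finset.mul_sum]
  rw [mul_right_inj' (by positivity)]
  have hsum : ∀ x, G.totalRho x = ∑ A, ∑ z, G.rho A z x := fun x => by
    rw [totalRho, Finset.sum_comm]
    simp only [rho_comm _ x]
  have key : ∑ A, (G.tsCloserSet A u v).ncard + G.totalRho u =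
      ∑ A, (G.tsCloserSet A v u).ncard + G.totalRho v := by
    rw [hsum, hsum, ← Finset.sum_add_distrib, ← Finset.sum_add_distrib]
    exact Finset.sum_congr rfl fun A _ => ncard_lt_add_sum
      (fun z => hG.rho_le_rho_add_one A z h.symm) (fun z => hG.rho_le_rho_add_one A z h)
  norm_cast
  omega

/-! ### Distances in the wreath product with a complete graph. -/

section Wreath

variable {W : Type*}

theorem wreath_top_adj_update [DecidableEq V] {y : V → W} {x : V} {c : W} (h : y x ≠ c) :
    (G.wreath (⊤ : SimpleGraph W)).Adj (y, x) (Function.update y x c, x) :=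
  Or.inl ⟨rfl, fun j hj => (Function.update_of_ne hj _ _).symm, by simpa using h⟩

theorem wreath_adj_of_adj (H : SimpleGraph W) (y : V → W) {x x' : V} (h : G.Adj x x') :
    (G.wreath H).Adj (y, x) (y, x') :=
  Or.inr ⟨rfl, h⟩

variable [Fintype V] [DecidableEq W]

/-- The set of vertices on which two colourings differ. -/
def diffSet (y y' : V → W) : Finset V :=
  Finset.univ.filter fun j => y j ≠ y' j

@[simp]
theorem mem_diffSet {y y' : V → W} {j : V} : j ∈ diffSet y y' ↔ y j ≠ y' j := by
  simp [diffSet]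

theorem diffSet_update [DecidableEq V] (y y' : V → W) (x : V) :
    diffSet (Function.update y x (y' x)) y' = (diffSet y y').erase x := by
  ext j
  by_cases hj : j = x
  · subst hj; simp
  · simp [hj]

/-- A walk in `G` that visits all vertices with a wrong colour lifts to the wreath product. -/
theorem exists_wreath_walk {x x' : V} (w : G.Walk x x') (y y' : V → W)
    (hw : ∀ a ∈ diffSet y y', a ∈ w.support) :
    ∃ p : (G.wreath (⊤ : SimpleGraph W)).Walk (y, x) (y', x'),
      p.length = w.length + (diffSet y y').card := by
  classical
  -- A wrong colour at the current position is corrected at once, in one step because `⊤` is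
  -- complete. So the start may be assumed to have the right colour.
  have fix : ∀ {u v : V} (w : G.Walk u v) (y : V → W),
      (∀ y, (∀ a ∈ diffSet y y', a ∈ w.support) → u ∉ diffSet y y' →
        ∃ p : (G.wreath (⊤ : SimpleGraph W)).Walk (y, u) (y', v),
          p.length = w.length + (diffSet y y').card) →
      (∀ a ∈ diffSet y y', a ∈ w.support) →
        ∃ p : (G.wreath (⊤ : SimpleGraph W)).Walk (y, u) (y', v),
          p.length = w.length + (diffSet y y').card := by
    intro u v w y H hw
    by_cases hu : u ∈ diffSet y y'
    · obtain ⟨p, hp⟩ := H (Function.update y u (y' u))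
        (fun a ha => hw a (by rw [diffSet_update] at ha; exact Finset.mem_of_mem_erase ha))
        (by simp)
      refine ⟨.cons (wreath_top_adj_update (mem_diffSet.1 hu)) p, ?_⟩
      rw [Walk.length_cons, hp, diffSet_update, ← Finset.card_erase_add_one hu, add_assoc]
    · exact H y hw hu
  induction w generalizing y with
  | nil =>
    refine fix _ y (fun y hw hu => ?_) hw
    have hy : y = y' := by
      ext1 j
      by_contra hj
      have := hw j (mem_diffSet.2 hj)
      rw [Walk.support_nil, List.mem_singleton] at this
      exact hu (this ▸ mem_diffSet.2 hj)
    subst hy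
    exact ⟨.nil, by simp [diffSet]⟩
  | @cons u v x' h w ih =>
    refine fix _ y (fun y hw hu => ?_) hw
    obtain ⟨p, hp⟩ := ih y (fun a ha => by
      have := hw a ha
      rw [Walk.support_cons, List.mem_cons] at this
      exact this.resolve_left fun e => hu (e ▸ ha))
    exact ⟨.cons (wreath_adj_of_adj _ y h) p, by rw [Walk.length_cons, hp, Walk.length_cons, add_right_comm]⟩

/-- A walk in the wreath product projects to a walk in `G` that visits all vertices whose colour
is changed. -/
theorem exists_walk_of_wreath_walk {a b : (V → W) × V}
    (p : (G.wreath (⊤ : SimpleGraph W)).Walk a b) :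
    ∃ w : G.Walk a.2 b.2, (∀ j ∈ diffSet a.1 b.1, j ∈ w.support) ∧
      w.length + (diffSet a.1 b.1).card ≤ p.length := by
  classical
  induction p with
  | nil => exact ⟨.nil, by simp, by simp [diffSet]⟩
  | @cons a c b h p ih =>
    obtain ⟨w, hw, hl⟩ := ih
    rw [Walk.length_cons]
    rcases id h with ⟨h₁, h₂, -⟩ | ⟨h₁, h₂⟩
    -- A colour change accounts for at most one more differing vertex, the current position, which
    -- the projected walk visits.
    · have hsub : diffSet a.1 b.1 ⊆ insert a.2 (diffSet c.1 b.1) := by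
        intro j hj
        by_cases hja : j = a.2
        · simp [hja]
        · rw [mem_diffSet, h₂ j hja] at hj
          simp [hj]
      refine ⟨w.copy h₁.symm rfl, fun j hj => ?_, ?_⟩
      · rw [Walk.support_copy]
        rcases Finset.mem_insert.1 (hsub hj) with rfl | hj
        · rw [h₁]; exact w.start_mem_support
        · exact hw j hj
      · rw [Walk.length_copy]
        have := (Finset.card_le_card hsub).trans (Finset.card_insert_le _ _)
        omega
    · rw [show diffSet a.1 b.1 = diffSet c.1 b.1 by rw [h₁]]
      refine ⟨.cons h₂ w, fun j hj => ?_, ?_⟩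
      · simp [hw j hj]
      · rw [Walk.length_cons]
        omega

theorem Connected.wreath_top [Nonempty W] (hG : G.Connected) :
    (G.wreath (⊤ : SimpleGraph W)).Connected := by
  have := hG.nonempty
  refine ⟨fun ⟨y, x⟩ ⟨y', x'⟩ => ?_⟩
  obtain ⟨w, hw⟩ := hG.exists_walk_cover (diffSet y y') x x'
  exact (exists_wreath_walk w y y' hw).choose.reachable

theorem Connected.dist_wreath_top [Nonempty W] (hG : G.Connected) (a b : (V → W) × V) :
    (G.wreath (⊤ : SimpleGraph W)).dist a b =
      G.rho (diffSet a.1 b.1) a.2 b.2 + (diffSet a.1 b.1).card := by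
  apply le_antisymm
  · obtain ⟨w, hw, hl⟩ := hG.exists_walk_length_eq_rho (diffSet a.1 b.1) a.2 b.2
    obtain ⟨p, hp⟩ := exists_wreath_walk w a.1 b.1 hw
    exact (dist_le p).trans_eq (by rw [hp, hl])
  · obtain ⟨p, hp⟩ := (hG.wreath_top (W := W)).exists_walk_length_eq_dist a b
    obtain ⟨w, hw, hl⟩ := exists_walk_of_wreath_walk p
    have := rho_le_length w hw
    omega

/-- With only two colours, a colouring is determined by where it differs from `y`. -/
theorem diffSet_bijective (y : V → Fin 2) :
    Function.Bijective fun y' : V → Fin 2 => diffSet y' y := by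
  classical
  refine (Fintype.bijective_iff_injective_and_card _).2 ⟨fun y₁ y₂ h => ?_, by simp⟩
  ext1 j
  have := Finset.ext_iff.1 h j
  simp only [mem_diffSet] at this
  omega

theorem Connected.sum_dist_wreath [DecidableEq V] (hG : G.Connected) (b : (V → Fin 2) × V) :
    ∑ a, (G.wreath (⊤ : SimpleGraph (Fin 2))).dist a b =
      G.totalRho b.2 + Fintype.card V * ∑ A : Finset V, A.card := by
  simp only [hG.dist_wreath_top, Fintype.sum_prod_type_right, Finset.sum_add_distrib, totalRho]
  congr 1
  · refine Finset.sum_congr rfl fun z _ => ?_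
    simp only [rho_comm _ b.2]
    exact (diffSet_bijective b.1).sum_comp fun A => G.rho A z b.2
  · rw [(diffSet_bijective b.1).sum_comp Finset.card]
    simp

/-- `G ≀ K₂` is distance-balanced if and only if `G` is `½`TS-distance-balanced. -/
theorem Connected.isDistanceBalanced_wreath_iff (hG : G.Connected) :
    (G.wreath (⊤ : SimpleGraph (Fin 2))).IsDistanceBalanced ↔
      G.IsTSDistanceBalanced (1 / 2) := by
  classical
  rw [hG.wreath_top.isDistanceBalanced_iff, hG.isTSDistanceBalanced_half_iff]
  simp only [hG.sum_dist_wreath, add_left_inj]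
  constructor
  · exact fun H u v h => H (0, u) (0, v) (Or.inr ⟨rfl, h⟩)
  -- The sum depends on the position only, so edges that change a colour impose no condition.
  · rintro H ⟨y, x⟩ ⟨y', x'⟩ (⟨h, -⟩ | ⟨-, h⟩)
    · exact congrArg _ h
    · exact H _ _ h

end Wreath

end SimpleGraph

/-! ### Bit-parallel breadth-first search. -/

/-- The bit mask of the numbers `a < 2 ^ n` whose `u`-th bit is not set. -/
def bitOffMask (n u : ℕ) : ℕ := (2 ^ 2 ^ n - 1) / (2 ^ 2 ^ u + 1)

/-- `X` encodes a family of sets of bit positions. The result encodes the family of all sets that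
are in `X` after `u` is removed. -/
def addVisited (n u X : ℕ) : ℕ :=
  (X &&& bitOffMask n u ||| (X &&& bitOffMask n u) <<< 2 ^ u) % 2 ^ 2 ^ n

/-- Concatenation of the `N`-bit blocks `f 0, …, f (m - 1)`. -/
def packBlocks (N : ℕ) (f : ℕ → ℕ) : ℕ → ℕ
  | 0 => 0
  | m + 1 => packBlocks N f m ||| f m <<< (m * N)

/-- The union of those blocks of `P` whose indices are in `l`. -/
def orBlocks (N P : ℕ) (l : List ℕ) : ℕ :=
  l.foldr (fun w X => P >>> (w * N) ||| X) 0

/-- The number of bits of `x` in the positions below `2 ^ m`. -/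
def bitCount : ℕ → ℕ → ℕ
  | 0, x => x % 2
  | m + 1, x => bitCount m x + bitCount m (x >>> 2 ^ m)

/-- The number of bits in the first `n` blocks of length `2 ^ n`. -/
def blockCount (n P : ℕ) : ℕ :=
  ∑ u ∈ Finset.range n, bitCount n (P >>> (u * 2 ^ n))

/-- Application of `f` to `x`, in a form that makes the kernel evaluate `x` first. -/
def strictApply {α : Type*} (x : ℕ) (f : ℕ → α) : α :=
  Nat.casesOn x (f 0) fun k => f (k + 1)

/-- One step of the breadth-first search for covering walks. -/
def searchStep (n : ℕ) (nbrs : ℕ → List ℕ) (P : ℕ) : ℕ :=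
  packBlocks (2 ^ n) (fun u => addVisited n u (orBlocks (2 ^ n) P (u :: nbrs u))) n

/-- The walks of length zero that end in `s`. -/
def searchInit (n s : ℕ) : ℕ :=
  packBlocks (2 ^ n) (fun u => if u = s then addVisited n u 1 else 0) n

/-- The number of states found in the first `k` stages of the search, and in the final stage. -/
def searchCount (n : ℕ) (nbrs : ℕ → List ℕ) : ℕ → ℕ → ℕ → ℕ × ℕ
  | 0, P, acc => (acc, blockCount n P)
  | k + 1, P, acc => strictApply P fun P => strictApply (acc + blockCount n P) fun acc =>
      searchCount n nbrs k (searchStep n nbrs P) acc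

theorem strictApply_eq {α : Type*} (x : ℕ) (f : ℕ → α) : strictApply x f = f x := by
  cases x <;> rfl

/-- The bound `hf` keeps neighbouring blocks from overlapping. -/
theorem testBit_packBlocks {N : ℕ} {f : ℕ → ℕ} (hf : ∀ u, f u < 2 ^ N) (m u : ℕ) {a : ℕ}
    (ha : a < N) : (packBlocks N f m).testBit (u * N + a) = (decide (u < m) && (f u).testBit a) := by
  induction m with
  | zero => simp [packBlocks]
  | succ m ih =>
    rw [packBlocks, Nat.testBit_or, ih, Nat.testBit_shiftLeft]
    rcases lt_trichotomy u m with h | rfl | h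
    · have : (u + 1) * N ≤ m * N := Nat.mul_le_mul_right _ h
      have h₁ : ¬ m * N ≤ u * N + a := by rw [add_mul] at this; omega
      simp [h, h₁, h.trans (Nat.lt_succ_self m)]
    · simp
    · have : (m + 1) * N ≤ u * N := Nat.mul_le_mul_right _ h
      have h₁ : (f m).testBit (u * N + a - m * N) = false :=
        Nat.testBit_lt_two_pow ((hf m).trans_le
          (Nat.pow_le_pow_right two_pos (by rw [add_mul] at this; omega)))
      have h₂ : ¬ u < m := by omega
      have h₃ : ¬ u < m + 1 := by omega
      simp [h₁, h₂, h₃]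

theorem testBit_orBlocks (N P : ℕ) (l : List ℕ) (a : ℕ) :
    (orBlocks N P l).testBit a = true ↔ ∃ w ∈ l, P.testBit (w * N + a) = true := by
  induction l with
  | nil => simp [orBlocks]
  | cons w l ih =>
    rw [orBlocks, List.foldr_cons, Nat.testBit_or, Bool.or_eq_true, Nat.testBit_shiftRight,
      ← orBlocks, ih]
    simp

theorem bitCount_eq_sum (m x : ℕ) :
    bitCount m x = ∑ a ∈ Finset.range (2 ^ m), if x.testBit a then 1 else 0 := by
  induction m generalizing x with
  | zero =>
    rcases Nat.mod_two_eq_zero_or_one x with h | h <;> simp [bitCount, Finset.filter_singleton, h]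
  | succ m ih =>
    rw [bitCount, ih, ih, pow_succ, mul_two, Finset.sum_range_add]
    simp [Nat.testBit_shiftRight]

theorem blockCount_eq_sum (n P : ℕ) :
    blockCount n P =
      ∑ u : Fin n, ∑ a : Fin (2 ^ n), if P.testBit (u * 2 ^ n + a) then 1 else 0 := by
  rw [blockCount, Finset.sum_range]
  refine Finset.sum_congr rfl fun u _ => ?_
  rw [bitCount_eq_sum, Finset.sum_range]
  simp [Nat.testBit_shiftRight]

theorem searchCount_eq (n : ℕ) (nbrs : ℕ → List ℕ) (k P acc : ℕ) :
    searchCount n nbrs k P acc =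
      (acc + ∑ i ∈ Finset.range k, blockCount n ((searchStep n nbrs)^[i] P),
        blockCount n ((searchStep n nbrs)^[k] P)) := by
  induction k generalizing P acc with
  | zero => simp [searchCount]
  | succ k ih =>
    rw [searchCount, strictApply_eq, strictApply_eq, ih, Finset.sum_range_succ']
    simp only [Function.iterate_succ_apply, Function.iterate_zero, id]
    rw [add_assoc, add_comm (blockCount n P)]

/-- The set of positions of the bits of `a`. -/
def bitSet (n a : ℕ) : Finset (Fin n) :=
  Finset.univ.filter fun i => a.testBit i

@[simp]
theorem mem_bitSet {n a : ℕ} {i : Fin n} : i ∈ bitSet n a ↔ a.testBit i = true := by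
  simp [bitSet]

theorem bitSet_bijective (n : ℕ) : Function.Bijective fun a : Fin (2 ^ n) => bitSet n a := by
  refine (Fintype.bijective_iff_injective_and_card _).2 ⟨fun a b h => ?_, by simp⟩
  refine Fin.ext (Nat.eq_of_testBit_eq fun i => ?_)
  by_cases hi : i < n
  · have := Finset.ext_iff.1 h ⟨i, hi⟩
    simp only [mem_bitSet] at this
    exact Bool.eq_iff_iff.2 this
  · have := Nat.pow_le_pow_right two_pos (not_lt.1 hi)
    rw [Nat.testBit_lt_two_pow (a.2.trans_le this), Nat.testBit_lt_two_pow (b.2.trans_le this)]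

/-- Adding `2 ^ u` to a number whose bit `u` is off causes no carry. -/
theorem testBit_two_pow_add_of_ne {u b i : ℕ} (h : b.testBit u = false) (hi : i ≠ u) :
    (2 ^ u + b).testBit i = b.testBit i := by
  induction u generalizing b i with
  | zero =>
    obtain ⟨j, rfl⟩ := Nat.exists_eq_succ_of_ne_zero hi
    rw [Nat.testBit_zero, decide_eq_false_iff_not] at h
    rw [Nat.succ_eq_add_one, Nat.testBit_add_one, Nat.testBit_add_one]
    congr 1
    omega
  | succ u ih =>
    rw [Nat.testBit_add_one] at h
    have h₁ : (2 ^ (u + 1) + b) / 2 = 2 ^ u + b / 2 := by rw [pow_succ]; omega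
    cases i with
    | zero =>
      rw [Nat.testBit_zero, Nat.testBit_zero, pow_succ, Nat.mul_add_mod_self_right]
    | succ j =>
      rw [Nat.testBit_add_one, Nat.testBit_add_one, h₁, ih h (by omega)]

theorem bitSet_sub_two_pow {n a : ℕ} {u : Fin n} (h : a.testBit u = true) :
    bitSet n (a - 2 ^ (u : ℕ)) = (bitSet n a).erase u := by
  obtain ⟨b, rfl⟩ := Nat.exists_eq_add_of_le (Nat.ge_two_pow_of_testBit h)
  rw [Nat.testBit_two_pow_add_eq, Bool.not_eq_true'] at h
  rw [Nat.add_sub_cancel_left]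
  ext i
  rw [Finset.mem_erase, mem_bitSet, mem_bitSet]
  by_cases hi : i = u
  · subst hi; simp [h]
  rw [testBit_two_pow_add_of_ne h fun e => hi (Fin.ext e)]
  simp [hi]

theorem bitSet_zero (n : ℕ) : bitSet n 0 = ∅ := by
  ext i; simp

theorem bitSet_eq_empty {n a : ℕ} (ha : a < 2 ^ n) : bitSet n a = ∅ ↔ a = 0 := by
  constructor
  · intro h
    rw [← bitSet_zero] at h
    exact congrArg Fin.val ((bitSet_bijective n).1 (a₁ := ⟨a, ha⟩) (a₂ := ⟨0, by positivity⟩) h)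
  · rintro rfl
    exact bitSet_zero n

/-- The mask in its closed form has the right bits. -/
def BitOffMaskSpec (n : ℕ) : Prop :=
  ∀ u < n, ∀ a < 2 ^ n, (bitOffMask n u).testBit a = !a.testBit u

/-- The mask keeps the sets without `u`; the shift by `2 ^ u` copies each of them to the set with
`u` added. The witness `b` is `a` with bit `u` cleared. -/
theorem testBit_addVisited {n : ℕ} (hn : BitOffMaskSpec n) {u : Fin n} {a : ℕ} (ha : a < 2 ^ n)
    (X : ℕ) : ∃ b < 2 ^ n, bitSet n b = (bitSet n a).erase u ∧
      (addVisited n u X).testBit a = X.testBit b := by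
  cases h : a.testBit u with
  | false =>
    refine ⟨a, ha, (Finset.erase_eq_of_notMem (by simp [h])).symm, ?_⟩
    -- Here the subtraction turns bit `u` on, so the mask leaves nothing that the shift could bring
    -- to position `a`.
    have h₁ : 2 ^ (u : ℕ) ≤ a → (bitOffMask n u).testBit (a - 2 ^ (u : ℕ)) = false := by
      intro hle
      rw [hn u u.2 _ ((Nat.sub_le _ _).trans_lt ha), Bool.not_eq_false']
      rw [← Nat.add_sub_cancel' hle, Nat.testBit_two_pow_add_eq] at h
      simpa using h
    rw [addVisited, Nat.testBit_mod_two_pow, Nat.testBit_or, Nat.testBit_shiftLeft,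
      Nat.testBit_and, Nat.testBit_and, hn u u.2 a ha, h]
    by_cases hle : 2 ^ (u : ℕ) ≤ a
    · simp [ha, h₁ hle]
    · simp [ha, hle]
  | true =>
    refine ⟨a - 2 ^ (u : ℕ), (Nat.sub_le _ _).trans_lt ha, bitSet_sub_two_pow h, ?_⟩
    have hle := Nat.ge_two_pow_of_testBit h
    have h₁ : (bitOffMask n u).testBit (a - 2 ^ (u : ℕ)) = true := by
      rw [hn u u.2 _ ((Nat.sub_le _ _).trans_lt ha), Bool.not_eq_true']
      rw [← Nat.add_sub_cancel' hle, Nat.testBit_two_pow_add_eq] at h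
      simpa using h
    rw [addVisited, Nat.testBit_mod_two_pow, Nat.testBit_or, Nat.testBit_shiftLeft,
      Nat.testBit_and, Nat.testBit_and, hn u u.2 a ha, h]
    simp [ha, h₁, hle]

theorem addVisited_lt (n u X : ℕ) : addVisited n u X < 2 ^ 2 ^ n :=
  Nat.mod_lt _ (by positivity)

/-! ### Correctness of the search. -/

namespace SimpleGraph

variable {n : ℕ} {G : SimpleGraph (Fin n)}

/-- There is a walk from `u` to `s` of length at most `k` that visits all of `A`. -/
def HasCover {V : Type*} (G : SimpleGraph V) (s : V) (k : ℕ) (A : Finset V) (u : V) : Prop :=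
  ∃ w : G.Walk u s, (∀ i ∈ A, i ∈ w.support) ∧ w.length ≤ k

theorem hasCover_zero {V : Type*} [DecidableEq V] {G : SimpleGraph V} {s u : V} {A : Finset V} :
    G.HasCover s 0 A u ↔ u = s ∧ A.erase u = ∅ := by
  constructor
  · rintro ⟨w, hw, hl⟩
    cases w with
    | nil =>
      refine ⟨rfl, Finset.eq_empty_of_forall_notMem fun i hi => ?_⟩
      simp only [Finset.mem_erase] at hi
      simpa [hi.1] using hw i hi.2
    | cons => simp at hl
  · rintro ⟨rfl, h⟩
    refine ⟨.nil, fun i hi => ?_, by simp⟩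
    by_contra hne
    simp only [Walk.support_nil, List.mem_singleton] at hne
    exact Finset.notMem_empty i (h ▸ Finset.mem_erase.2 ⟨hne, hi⟩)

/-- The start `u` counts as visited, so only `A.erase u` is left for the rest of the walk. The
option `v = u` is a pause, allowed since `k` is only an upper bound. -/
theorem hasCover_succ {V : Type*} [DecidableEq V] {G : SimpleGraph V} {s u : V} {k : ℕ}
    {A : Finset V} : G.HasCover s (k + 1) A u ↔
      ∃ v, (v = u ∨ G.Adj u v) ∧ G.HasCover s k (A.erase u) v := by
  constructor
  · rintro ⟨w, hw, hl⟩
    cases w with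
    | nil =>
      refine ⟨s, Or.inl rfl, .nil, fun i hi => ?_, by simp⟩
      exact hw i (Finset.mem_of_mem_erase hi)
    | @cons _ v _ h w =>
      refine ⟨v, Or.inr h, w, fun i hi => ?_, by simpa using hl⟩
      have := hw i (Finset.mem_of_mem_erase hi)
      rw [Walk.support_cons, List.mem_cons] at this
      exact this.resolve_left (Finset.ne_of_mem_erase hi)
  · rintro ⟨v, rfl | h, w, hw, hl⟩
    · refine ⟨w, fun i hi => ?_, by omega⟩
      by_cases hv : i = v
      · rw [hv]; exact w.start_mem_support
      · exact hw i (Finset.mem_erase.2 ⟨hv, hi⟩)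
    · refine ⟨.cons h w, fun i hi => ?_, by simpa using hl⟩
      by_cases hv : i = u
      · simp [hv]
      · simp [hw i (Finset.mem_erase.2 ⟨hv, hi⟩)]

/-- The bits of `P` describe the walks to `s` of length at most `k`. -/
def Represents (G : SimpleGraph (Fin n)) (s : Fin n) (k P : ℕ) : Prop :=
  ∀ u : Fin n, ∀ a < 2 ^ n,
    P.testBit (u * 2 ^ n + a) = true ↔ G.HasCover s k (bitSet n a) u

theorem represents_searchInit (hn : BitOffMaskSpec n) (s : Fin n) :
    G.Represents s 0 (searchInit n s) := by
  intro u a ha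
  rw [searchInit, testBit_packBlocks _ _ _ ha, hasCover_zero]
  · by_cases hu : u = s
    · subst hu
      obtain ⟨b, hb, hba, h⟩ := testBit_addVisited hn (u := u) ha 1
      rw [if_pos rfl, h, ← hba, bitSet_eq_empty hb]
      simp [Nat.testBit_one_eq_true_iff_self_eq_zero]
    · have : (u : ℕ) ≠ s := fun e => hu (Fin.ext e)
      simp [hu, this]
  · intro u
    split_ifs
    · exact addVisited_lt _ _ _
    · positivity

/-- `nbrs u` lists the neighbours of `u`. -/
def IsNeighborList (G : SimpleGraph (Fin n)) (nbrs : ℕ → List ℕ) : Prop :=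
  ∀ u : Fin n, (∀ v : Fin n, G.Adj u v ↔ (v : ℕ) ∈ nbrs u) ∧ ∀ v ∈ nbrs u, v < n

theorem Represents.searchStep (hn : BitOffMaskSpec n) {nbrs : ℕ → List ℕ}
    (hG : G.IsNeighborList nbrs) {s : Fin n} {k P : ℕ} (h : G.Represents s k P) :
    G.Represents s (k + 1) (searchStep n nbrs P) := by
  intro u a ha
  rw [_root_.searchStep, testBit_packBlocks (fun _ => addVisited_lt _ _ _) _ _ ha, hasCover_succ]
  obtain ⟨b, hb, hba, hbit⟩ :=
    testBit_addVisited hn (u := u) ha (orBlocks (2 ^ n) P (u :: nbrs u))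
  rw [hbit, decide_eq_true u.2, Bool.true_and, testBit_orBlocks, ← hba]
  constructor
  · rintro ⟨w, hw, hP⟩
    rcases List.mem_cons.1 hw with rfl | hw
    · exact ⟨u, Or.inl rfl, (h u b hb).1 hP⟩
    · have hlt := (hG u).2 w hw
      exact ⟨⟨w, hlt⟩, Or.inr (((hG u).1 ⟨w, hlt⟩).2 hw), (h ⟨w, hlt⟩ b hb).1 hP⟩
  · rintro ⟨v, rfl | hv, hc⟩
    · exact ⟨v, List.mem_cons_self, (h v b hb).2 hc⟩
    · exact ⟨v, List.mem_cons_of_mem _ (((hG u).1 v).1 hv), (h v b hb).2 hc⟩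

theorem represents_iterate (hn : BitOffMaskSpec n) {nbrs : ℕ → List ℕ}
    (hG : G.IsNeighborList nbrs) (s : Fin n) (k : ℕ) :
    G.Represents s k ((_root_.searchStep n nbrs)^[k] (searchInit n s)) := by
  induction k with
  | zero => exact represents_searchInit hn s
  | succ k ih =>
    rw [Function.iterate_succ_apply']
    exact ih.searchStep hn hG

/-- If the search finds all states after `K` steps, the graph is connected and the number of states
found before determines the sum of all `ρ_A(s, v)`. -/
theorem connected_and_totalRho_of_searchCount (hn : BitOffMaskSpec n) {nbrs : ℕ → List ℕ}
    (hG : G.IsNeighborList nbrs) (s : Fin n) {K t : ℕ}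
    (h : searchCount n nbrs K (searchInit n s) 0 = (t, n * 2 ^ n)) :
    G.Connected ∧ G.totalRho s + t = n * 2 ^ n * K := by
  rw [searchCount_eq, Prod.mk.injEq, zero_add] at h
  obtain ⟨rfl, hfull⟩ := h
  have hrep := represents_iterate hn hG s
  -- The final count equals the number of all states, so no bit can be missing.
  have hall : ∀ (u : Fin n) (a : Fin (2 ^ n)), G.HasCover s K (bitSet n a) u := by
    by_contra! hc
    obtain ⟨u, a, hua⟩ := hc
    rw [← hrep K u a a.2] at hua
    refine hfull.not_lt ?_
    rw [blockCount_eq_sum, ← Fintype.sum_prod_type']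
    calc _ < ∑ _x : Fin n × Fin (2 ^ n), 1 :=
          Finset.sum_lt_sum (fun x _ => by split_ifs <;> simp)
            ⟨(u, a), Finset.mem_univ _, by simp [hua]⟩
      _ = n * 2 ^ n := by simp
  have hconn : G.Connected := by
    have : Nonempty (Fin n) := ⟨s⟩
    have hs : ∀ u, G.Reachable u s := fun u =>
      (hall u ⟨0, by positivity⟩).choose.reachable
    exact ⟨fun u v => (hs u).trans (hs v).symm⟩
  refine ⟨hconn, ?_⟩
  have hrho : G.totalRho s = ∑ u : Fin n, ∑ a : Fin (2 ^ n), G.rho (bitSet n a) u s := by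
    refine Finset.sum_congr rfl fun u _ => ?_
    rw [← (bitSet_bijective n).sum_comp]
    exact Finset.sum_congr rfl fun a _ => rho_comm _ _ _
  have hcount : ∀ k, blockCount n ((_root_.searchStep n nbrs)^[k] (searchInit n s)) =
      ∑ u : Fin n, ∑ a : Fin (2 ^ n), if G.rho (bitSet n a) u s ≤ k then 1 else 0 := by
    intro k
    rw [blockCount_eq_sum]
    refine Finset.sum_congr rfl fun u _ => Finset.sum_congr rfl fun a _ => ?_
    exact if_congr ((hrep k u a a.2).trans hconn.rho_le_iff.symm) rfl rfl
  -- A state with value `ρ ≤ K` is present in exactly `K - ρ` of the stages `0, …, K - 1`.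
  have hpoint : ∀ (u : Fin n) (a : Fin (2 ^ n)), G.rho (bitSet n a) u s +
      ∑ k ∈ Finset.range K, (if G.rho (bitSet n a) u s ≤ k then 1 else 0) = K := by
    intro u a
    have hle : G.rho (bitSet n a) u s ≤ K := hconn.rho_le_iff.2 (hall u a)
    rw [Finset.sum_boole, Nat.cast_id]
    have : (Finset.range K).filter (G.rho (bitSet n a) u s ≤ ·) =
        Finset.Ico (G.rho (bitSet n a) u s) K := by
      ext k; simp [and_comm]
    rw [this, Nat.card_Ico]
    omega
  simp only [hcount]
  rw [hrho, Finset.sum_comm (s := Finset.range K), ← Finset.sum_add_distrib]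
  simp only [Finset.sum_comm (s := Finset.range K), ← Finset.sum_add_distrib, hpoint]
  simp [mul_assoc]

end SimpleGraph

/-! ### Computations for the two graphs. -/

/-- The neighbours in the wheel graph. -/
def wheel7Nbrs (u : ℕ) : List ℕ :=
  [[1, 2, 3, 4, 5, 6], [0, 2, 6], [0, 1, 3], [0, 2, 4], [0, 3, 5], [0, 4, 6], [0, 1, 5]].getD u []

/-- The neighbours in the graph `H₉`. -/
def graphH9Nbrs (u : ℕ) : List ℕ :=
  [[1, 2, 7, 8], [0, 2, 3], [0, 1, 3], [1, 2, 4, 5], [3, 5, 6], [3, 4, 6], [4, 5, 7, 8],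
    [0, 6, 8], [0, 6, 7]].getD u []

instance : DecidableRel wheel7.Adj :=
  inferInstanceAs (DecidableRel (SimpleGraph.fromRel _).Adj)

instance : DecidableRel graphH9.Adj :=
  inferInstanceAs (DecidableRel (SimpleGraph.fromRel _).Adj)

theorem isNeighborList_wheel7 : wheel7.IsNeighborList wheel7Nbrs := by
  unfold SimpleGraph.IsNeighborList
  decide +kernel

theorem isNeighborList_graphH9 : graphH9.IsNeighborList graphH9Nbrs := by
  unfold SimpleGraph.IsNeighborList
  decide +kernel

/-- The mask alternates `2 ^ u` ones and `2 ^ u` zeros; summing the geometric series gives the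
quotient in `bitOffMask`. Only the needed sizes are checked. -/
theorem bitOffMaskSpec_seven : BitOffMaskSpec 7 := by
  unfold BitOffMaskSpec
  decide +kernel

theorem bitOffMaskSpec_nine : BitOffMaskSpec 9 := by
  unfold BitOffMaskSpec
  decide +kernel

/-- Seven steps reach all states, and `2430 = 7 * 2 ^ 7 * 7 - 3842`. -/
theorem searchCount_wheel7 (s : Fin 7) :
    searchCount 7 wheel7Nbrs 7 (searchInit 7 s) 0 = (2430, 7 * 2 ^ 7) := by
  revert s
  decide +kernel

/-- Nine steps reach all states, and `14784 = 9 * 2 ^ 9 * 9 - 26688`; from vertex `1` the subtrahend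
is `26656`. -/
theorem searchCount_graphH9_zero :
    searchCount 9 graphH9Nbrs 9 (searchInit 9 (0 : Fin 9)) 0 =
      (14784, 9 * 2 ^ 9) := by
  decide +kernel

theorem searchCount_graphH9_one :
    searchCount 9 graphH9Nbrs 9 (searchInit 9 (1 : Fin 9)) 0 =
      (14816, 9 * 2 ^ 9) := by
  decide +kernel

theorem wheel7_connected : wheel7.Connected :=
  (SimpleGraph.connected_and_totalRho_of_searchCount bitOffMaskSpec_seven isNeighborList_wheel7 0
    (searchCount_wheel7 0)).1

theorem totalRho_wheel7 (u : Fin 7) : wheel7.totalRho u = 3842 := by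
  have := (SimpleGraph.connected_and_totalRho_of_searchCount bitOffMaskSpec_seven
    isNeighborList_wheel7 u (searchCount_wheel7 u)).2
  omega

theorem graphH9_connected : graphH9.Connected :=
  (SimpleGraph.connected_and_totalRho_of_searchCount bitOffMaskSpec_nine isNeighborList_graphH9 0
    searchCount_graphH9_zero).1

theorem totalRho_graphH9_zero : graphH9.totalRho 0 = 26688 := by
  have h := (SimpleGraph.connected_and_totalRho_of_searchCount bitOffMaskSpec_nine
    isNeighborList_graphH9 0 searchCount_graphH9_zero).2
  exact Nat.add_right_cancel (h.trans (by norm_num))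

theorem totalRho_graphH9_one : graphH9.totalRho 1 = 26656 := by
  have h := (SimpleGraph.connected_and_totalRho_of_searchCount bitOffMaskSpec_nine
    isNeighborList_graphH9 1 searchCount_graphH9_one).2
  exact Nat.add_right_cancel (h.trans (by norm_num))

/-! ### Ordinary distances in the two graphs, and the conclusion. -/

/-- A function that satisfies the local conditions of a distance function is the distance. -/
theorem SimpleGraph.dist_eq_of_local {V : Type*} {G : SimpleGraph V} {s : V} {f : V → ℕ}
    (h₀ : f s = 0) (hle : ∀ u v, G.Adj u v → f u ≤ f v + 1)
    (hdesc : ∀ u, u ≠ s → ∃ v, G.Adj u v ∧ f u = f v + 1) (u : V) : G.dist u s = f u := by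
  have upper : ∀ k u, f u = k → ∃ w : G.Walk u s, w.length = k := by
    intro k
    induction k with
    | zero =>
      intro u hu
      by_cases h : u = s
      · subst h
        exact ⟨.nil, rfl⟩
      · obtain ⟨v, -, hv⟩ := hdesc u h
        omega
    | succ k ih =>
      intro u hu
      obtain ⟨v, hv, hfv⟩ := hdesc u (by rintro rfl; omega)
      obtain ⟨w, hw⟩ := ih v (by omega)
      exact ⟨.cons hv w, by simp [hw]⟩
  -- Descent along `f` gave a walk of length `f u`; none is shorter, since `f` drops by at most one
  -- per edge.
  have lower : ∀ {u t : V} (w : G.Walk u t), f u ≤ f t + w.length := by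
    intro u t w
    induction w with
    | nil => simp
    | cons h w ih =>
      have := hle _ _ h
      rw [Walk.length_cons]
      omega
  obtain ⟨w, hw⟩ := upper _ u rfl
  obtain ⟨q, hq⟩ := w.reachable.exists_walk_length_eq_dist
  have := lower q
  have := dist_le w
  omega

/-- The distance function of the wheel graph. -/
def wheel7Dist (v u : Fin 7) : ℕ :=
  if u = v then 0 else if wheel7.Adj u v then 1 else 2

/-- The distance function of `H₉`. -/
def graphH9Dist (v u : Fin 9) : ℕ :=
  if u = v then 0 else if graphH9.Adj u v then 1 else
    if ∃ w, graphH9.Adj u w ∧ graphH9.Adj w v then 2 else 3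

theorem dist_wheel7 (u v : Fin 7) : wheel7.dist u v = wheel7Dist v u :=
  SimpleGraph.dist_eq_of_local (f := wheel7Dist v) (by revert v; decide +kernel)
    (by revert v; decide +kernel) (by revert v; decide +kernel) u

theorem dist_graphH9 (u v : Fin 9) : graphH9.dist u v = graphH9Dist v u :=
  SimpleGraph.dist_eq_of_local (f := graphH9Dist v) (by revert v; decide +kernel)
    (by revert v; decide +kernel) (by revert v; decide +kernel) u

/-- The distance sum is 6 at the centre and 9 on the rim. -/
theorem not_isDistanceBalanced_wheel7 : ¬ wheel7.IsDistanceBalanced := by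
  rw [wheel7_connected.isDistanceBalanced_iff]
  simp only [dist_wheel7]
  decide +kernel

/-- Every vertex has distance sum 14: `4 + 2·2 + 2·3` for degree 4, `3 + 4·2 + 3` for degree 3. -/
theorem isDistanceBalanced_graphH9 : graphH9.IsDistanceBalanced := by
  rw [graphH9_connected.isDistanceBalanced_iff]
  simp only [dist_graphH9]
  decide +kernel

theorem isDistanceBalanced_top_fin_two : (⊤ : SimpleGraph (Fin 2)).IsDistanceBalanced := by
  rw [SimpleGraph.connected_top.isDistanceBalanced_iff]
  simp only [SimpleGraph.dist_top]
  decide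

theorem isTSDistanceBalanced_wheel7 : wheel7.IsTSDistanceBalanced (1 / 2) :=
  wheel7_connected.isTSDistanceBalanced_half_iff.2 fun u v _ => by
    rw [totalRho_wheel7, totalRho_wheel7]

theorem not_isTSDistanceBalanced_graphH9 : ¬ graphH9.IsTSDistanceBalanced (1 / 2) := by
  rw [graphH9_connected.isTSDistanceBalanced_half_iff]
  intro h
  have := h 0 1 (by decide)
  rw [totalRho_graphH9_zero, totalRho_graphH9_one] at this
  omega

theorem corollary3p5 :
    -- `G ≀ H` distance-balanced does not imply `G` distance-balanced
    (¬ ∀ (V W : Type) [Finite V] [Finite W] (G : SimpleGraph V) (H : SimpleGraph W),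
        G.Connected → H.Connected → (G.wreath H).IsDistanceBalanced → G.IsDistanceBalanced) ∧
    -- `G` and `H` distance-balanced does not imply `G ≀ H` distance-balanced
    (¬ ∀ (V W : Type) [Finite V] [Finite W] (G : SimpleGraph V) (H : SimpleGraph W),
        G.Connected → H.Connected → G.IsDistanceBalanced → H.IsDistanceBalanced →
          (G.wreath H).IsDistanceBalanced) ∧
    -- the first witness: `W₇ ≀ K₂`
    (wheel7.Connected ∧
      (wheel7.wreath (⊤ : SimpleGraph (Fin 2))).Connected ∧
      (∀ u, wheel7.tsDist (1 / 2) u = 1 / (7 * 2 ^ 7) * 3842) ∧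
      wheel7.IsTSDistanceBalanced (1 / 2) ∧
      (wheel7.wreath (⊤ : SimpleGraph (Fin 2))).IsDistanceBalanced ∧
      ¬ wheel7.IsDistanceBalanced) ∧
    -- the second witness: `H₉ ≀ K₂`
    (graphH9.Connected ∧
      (graphH9.wreath (⊤ : SimpleGraph (Fin 2))).Connected ∧
      graphH9.tsDist (1 / 2) 0 = 1 / (9 * 2 ^ 9) * 26688 ∧
      graphH9.tsDist (1 / 2) 1 = 1 / (9 * 2 ^ 9) * 26656 ∧
      ¬ graphH9.IsTSDistanceBalanced (1 / 2) ∧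
      graphH9.IsDistanceBalanced ∧
      (⊤ : SimpleGraph (Fin 2)).IsDistanceBalanced ∧
      ¬ (graphH9.wreath (⊤ : SimpleGraph (Fin 2))).IsDistanceBalanced) := by
  have hW := wheel7_connected.isDistanceBalanced_wreath_iff.2 isTSDistanceBalanced_wheel7
  have hH := mt graphH9_connected.isDistanceBalanced_wreath_iff.1 not_isTSDistanceBalanced_graphH9
  refine ⟨fun h => not_isDistanceBalanced_wheel7
      (h _ _ wheel7 ⊤ wheel7_connected SimpleGraph.connected_top hW),
    fun h => hH (h _ _ graphH9 ⊤ graphH9_connected SimpleGraph.connected_top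
      isDistanceBalanced_graphH9 isDistanceBalanced_top_fin_two),
    ⟨wheel7_connected, wheel7_connected.wreath_top, fun u => ?_, isTSDistanceBalanced_wheel7, hW,
      not_isDistanceBalanced_wheel7⟩,
    ⟨graphH9_connected, graphH9_connected.wreath_top, ?_, ?_, not_isTSDistanceBalanced_graphH9,
      isDistanceBalanced_graphH9, isDistanceBalanced_top_fin_two, hH⟩⟩
  · rw [SimpleGraph.tsDist_half, totalRho_wheel7, Fintype.card_fin]
    norm_num
  · rw [SimpleGraph.tsDist_half, totalRho_graphH9_zero, Fintype.card_fin]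
    norm_num
  · rw [SimpleGraph.tsDist_half, totalRho_graphH9_one, Fintype.card_fin]
    norm_num
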